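/- A digital image is a set of points with a symmetric, antireflexive adjacency relation (a simple graph); write $x\leftrightarroweq y$ for "adjacent or equal". A map $f:X\to Y$ of images is continuous if $x\leftrightarrow y$ implies $f(x)\leftrightarroweq f(y)$. Let $[0,k]_{\mathbb Z}=\{0,1,\dots,k\}$, with consecutive integers adjacent. Continuous maps $f,g:X\to Y$ are homotopic, $f\simeq g$, if for some $k\ge 0$ there is $H:X\times[0,k]_{\mathbb Z}\to Y$ with $H(\cdot,0)=f$, $H(\cdot,k)=g$, all $H(\cdot,t):X\to Y$ continuous and all $H(x,\cdot):[0,k]_{\mathbb Z}\to Y$ continuous. Images $X,Y$ are homotopy equivalent if there are continuous $f:X\to Y$ and $g:Y\to X$ with $f\circ g\simeq \mathrm{id}_Y$ and $g\circ f\simeq\mathrm{id}_X$. A finite image is reducible if it is homotopy equivalent to an image with fewer points, and irreducible otherwise. Let $C_7$ be the cycle on 7 points; let $7_1$ be the image on the points $0,\dots,6$ consisting of the hexagon $0,1,2,3,4,5$ and a point $6$ adjacent to exactly $0$ and $3$; let $7_2$ be the image on $0,\dots,6$ with edges $01,12,20,03,36,14,46,25,56$. Let $X_1,\dots,X_{15}$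 be the images on $0,\dots,6$ with the following edges: * $X_{1}$: $01,06,12,23,34,45,56$ * $X_{2}$: $01,05,06,12,23,34,36,45$ * $X_{3}$: $01,02,03,12,14,25,36,46,56$ * $X_{4}$: $01,03,12,14,25,34,36,45,56$ * $X_{5}$: $01,05,06,12,23,26,34,45$ * $X_{6}$: $01,03,06,12,23,34,45,56$ * $X_{7}$: $01,04,05,12,23,34,35,46,56$ * $X_{8}$: $01,04,05,12,16,23,25,34,36,56$ * $X_{9}$: $01,03,06,12,23,24,34,45,56$ * $X_{10}$: $01,03,06,12,15,23,24,34,45,56$ * $X_{11}$: $01,03,06,12,16,23,24,34,45,56$ * $X_{12}$: $01,04,05,12,16,23,34,35,56$ * $X_{13}$: $01,04,12,15,16,23,34,45,46$ * $X_{14}$: $01,06,12,23,24,26,35,45$ * $X_{15}$: $01,04,06,12,15,23,34,35,36$ **Theorem.** 1. Up to homotopy equivalence there are exactly three connected irreducible images of 7 points, namely $C_7$, $7_1$ and $7_2$: these three images are connected and irreducible, no two of them are homotopy equivalent or isomorphic, and every connected irreducible image of 7 points is homotopy equivalent to one of them. 2. The images $X_1,\dots,X_{15}$ are pairwise non-isomorphic.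 An image $X$ of 7 points is isomorphic to one of them if and only if it is connected and has neither of the following two properties: (a) there is a complete subgraph $S\subseteq X$ such that every point of $X$ is in $S$ or adjacent to a point of $S$; (b) there are distinct points $x,y\in X$ with $N(x)\subseteq N(y)$, where $N(x)=\{z : z\leftrightarroweq x\}$. 3. $X_1$, $X_2$, $X_3$ are isomorphic to $C_7$, $7_1$, $7_2$ respectively, and $X_i$ is reducible for every $i$ with $4\le i\le 15$. -/

import Mathlib

universe u v w

namespace DigitalImage

/-! A digital image is a set of points with a symmetric antireflexive adjacency relation,
that is, a simple graph `G : SimpleGraph V` on its set of points `V`. -/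

/-- Adjacent or equal. -/
def AdjEq {V : Type u} (G : SimpleGraph V) (x y : V) : Prop :=
  G.Adj x y ∨ x = y

/-- Adjacent points are sent to adjacent or equal points. -/
def Continuous {V : Type u} {W : Type v} (G : SimpleGraph V) (H : SimpleGraph W)
    (f : V → W) : Prop :=
  ∀ x y, G.Adj x y → AdjEq H (f x) (f y)

/-- Digital homotopy of maps `f, g` from the image `G` to the image `H`. The path graph on
`Fin (k + 1)` is the digital interval from `0` to `k`. -/
def Homotopic {V : Type u} {W : Type v} (G : SimpleGraph V) (H : SimpleGraph W)
    (f g : V → W) : Prop :=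
  ∃ (k : ℕ) (F : V → Fin (k + 1) → W),
    (∀ x, F x 0 = f x) ∧ (∀ x, F x (Fin.last k) = g x) ∧
    (∀ t, Continuous G H (fun x => F x t)) ∧
    (∀ x, Continuous (SimpleGraph.pathGraph (k + 1)) H (F x))

/-- Homotopy equivalence of digital images. -/
def HomotopyEquiv {V : Type u} {W : Type v} (G : SimpleGraph V) (H : SimpleGraph W) : Prop :=
  ∃ (f : V → W) (g : W → V), Continuous G H f ∧ Continuous H G g ∧
    Homotopic H H (f ∘ g) id ∧ Homotopic G G (g ∘ f) id

/-- A finite image is reducible when it is homotopy equivalent to an image of fewer points. -/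
def Reducible {V : Type u} (G : SimpleGraph V) : Prop :=
  Finite V ∧ ∃ (W : Type u) (H : SimpleGraph W),
    Finite W ∧ Nat.card W < Nat.card V ∧ HomotopyEquiv G H

/-- A finite image is irreducible when it is not reducible. -/
def Irreducible {V : Type u} (G : SimpleGraph V) : Prop :=
  Finite V ∧ ¬ Reducible G

/-- `N(x)`: the point `x` together with all points adjacent to it. -/
def closedNbhd {V : Type u} (G : SimpleGraph V) (x : V) : Set V :=
  {y | AdjEq G y x}

/-- Some `N(x)` is contained in `N(y)` for another point `y`. -/
def HasPointReduction {V : Type u} (G : SimpleGraph V) : Prop :=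
  ∃ x y, x ≠ y ∧ closedNbhd G x ⊆ closedNbhd G y

/-- There is a complete subgraph `S` such that every point is in `S` or adjacent to a point
of `S`. -/
def HasSimplexReduction {V : Type u} (G : SimpleGraph V) : Prop :=
  ∃ S : Set V, G.IsClique S ∧ ∀ x, ∃ s ∈ S, AdjEq G x s

/-- The image on the points `0, …, 6` with a given list of edges. -/
def ofEdges (l : List (Fin 7 × Fin 7)) : SimpleGraph (Fin 7) :=
  SimpleGraph.fromRel (fun x y => (x, y) ∈ l)

instance ofEdges.decidableAdj (l : List (Fin 7 × Fin 7)) : DecidableRel (ofEdges l).Adj := fun x y =>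
  decidable_of_iff (x ≠ y ∧ ((x, y) ∈ l ∨ (y, x) ∈ l))
    (SimpleGraph.fromRel_adj (fun x y => (x, y) ∈ l) x y).symm

/-- `C₇`. -/
def c7 : SimpleGraph (Fin 7) :=
  SimpleGraph.cycleGraph 7

/-- `7₁`: a hexagon `0, …, 5` and a seventh point adjacent to two opposite points of it. -/
def seven1 : SimpleGraph (Fin 7) :=
  ofEdges [(0, 1), (1, 2), (2, 3), (3, 4), (4, 5), (5, 0), (0, 6), (6, 3)]

/-- `7₂`: a triangle `0, 1, 2`, each of whose points is joined to the central point `6` by a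
path through one further point. -/
def seven2 : SimpleGraph (Fin 7) :=
  ofEdges [(0, 1), (1, 2), (2, 0), (0, 3), (3, 6), (1, 4), (4, 6), (2, 5), (5, 6)]

/-- The three images of the catalog. -/
def catalog : Fin 3 → SimpleGraph (Fin 7) :=
  ![c7, seven1, seven2]

/-- The fifteen candidates `X₁, …, X₁₅`; `candidate i` is the one with number `i + 1`. -/
def candidate : Fin 15 → SimpleGraph (Fin 7) :=
  ![ofEdges [(0, 1), (0, 6), (1, 2), (2, 3), (3, 4), (4, 5), (5, 6)],
    ofEdges [(0, 1), (0, 5), (0, 6), (1, 2), (2, 3), (3, 4), (3, 6), (4, 5)],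
    ofEdges [(0, 1), (0, 2), (0, 3), (1, 2), (1, 4), (2, 5), (3, 6), (4, 6), (5, 6)],
    ofEdges [(0, 1), (0, 3), (1, 2), (1, 4), (2, 5), (3, 4), (3, 6), (4, 5), (5, 6)],
    ofEdges [(0, 1), (0, 5), (0, 6), (1, 2), (2, 3), (2, 6), (3, 4), (4, 5)],
    ofEdges [(0, 1), (0, 3), (0, 6), (1, 2), (2, 3), (3, 4), (4, 5), (5, 6)],
    ofEdges [(0, 1), (0, 4), (0, 5), (1, 2), (2, 3), (3, 4), (3, 5), (4, 6), (5, 6)],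
    ofEdges [(0, 1), (0, 4), (0, 5), (1, 2), (1, 6), (2, 3), (2, 5), (3, 4), (3, 6), (5, 6)],
    ofEdges [(0, 1), (0, 3), (0, 6), (1, 2), (2, 3), (2, 4), (3, 4), (4, 5), (5, 6)],
    ofEdges [(0, 1), (0, 3), (0, 6), (1, 2), (1, 5), (2, 3), (2, 4), (3, 4), (4, 5), (5, 6)],
    ofEdges [(0, 1), (0, 3), (0, 6), (1, 2), (1, 6), (2, 3), (2, 4), (3, 4), (4, 5), (5, 6)],
    ofEdges [(0, 1), (0, 4), (0, 5), (1, 2), (1, 6), (2, 3), (3, 4), (3, 5), (5, 6)],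
    ofEdges [(0, 1), (0, 4), (1, 2), (1, 5), (1, 6), (2, 3), (3, 4), (4, 5), (4, 6)],
    ofEdges [(0, 1), (0, 6), (1, 2), (2, 3), (2, 4), (2, 6), (3, 5), (4, 5)],
    ofEdges [(0, 1), (0, 4), (0, 6), (1, 2), (1, 5), (2, 3), (3, 4), (3, 5), (3, 6)]]

end DigitalImage

/-!
For a finite image the whole homotopy theory is governed by a single step of homotopy. Call an image
*shrinkable* when it has a continuous map to itself that is not surjective and sends every point to
itself or to a neighbour. The image of such a map is homotopy equivalent to the whole
(`Shrinkable.reducible`). Conversely, a continuous permutation of a finite image has a continuous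
inverse, a power of it. So if a homotopy that ends in the identity passes from a non-surjective stage
to a surjective one, composing with the inverse of the latter gives a shrinking map. Hence in an image
that is not shrinkable every map homotopic to the identity is surjective (`Homotopic.surjective`),
which gives two facts: a finite image is reducible exactly when it is shrinkable
(`reducible_iff_shrinkable`), and homotopy equivalent finite images that are not shrinkable are
isomorphic (`HomotopyEquiv.nonempty_iso`). Both elementary reductions make an image of at least two
points shrinkable.

What remains concerns finitely many images and is decided by computations in the kernel, on images of
the points `0, …, 6` encoded as natural numbers. Isomorphism and shrinkability are decided by
backtracking over the maps between two images (`isoCode_iff`, `shrinkCode_iff`). The images without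
reductions are found by a branching search (`search_pairs`) over intervals of images, in which some
pairs of points are known to be adjacent and some known not to be. A branch is cut when the known pairs
force an isolated point or a reduction, or when they are incompatible with a normal form of the
labelling that every image can be brought into (`exists_sorted`): a point of largest degree comes
first, then its neighbours, then the other points, each group by decreasing degree. The few hundred
labelled images that survive are isomorphic to candidates. Since irreducible images have neither
reduction, and the candidates that are not shrinkable are the three images of the catalog, this proves
all parts of the theorem.
-/

namespace DigitalImage

/-! ### Homotopies that shrink an image -/

theorem AdjEq.symm {V : Type u} {G : SimpleGraph V} {x y : V} (h : AdjEq G x y) :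
    AdjEq G y x :=
  h.imp SimpleGraph.Adj.symm Eq.symm

theorem adjEq_comm {V : Type u} {G : SimpleGraph V} {x y : V} : AdjEq G x y ↔ AdjEq G y x :=
  ⟨AdjEq.symm, AdjEq.symm⟩

theorem Continuous.adjEq {V : Type u} {W : Type v} {G : SimpleGraph V} {H : SimpleGraph W}
    {f : V → W} (hf : Continuous G H f) {x y : V} (h : AdjEq G x y) : AdjEq H (f x) (f y) := by
  rcases h with h | rfl
  · exact hf x y h
  · exact Or.inr rfl

theorem continuous_id {V : Type u} (G : SimpleGraph V) : Continuous G G id :=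
  fun _ _ h => Or.inl h

theorem Continuous.comp {U : Type u} {V : Type v} {W : Type w} {G : SimpleGraph U}
    {H : SimpleGraph V} {K : SimpleGraph W} {g : V → W} {f : U → V}
    (hg : Continuous H K g) (hf : Continuous G H f) : Continuous G K (g ∘ f) :=
  fun x y h => hg.adjEq (hf x y h)

theorem homotopic_of_adjEq {V : Type u} {W : Type v} {G : SimpleGraph V} {H : SimpleGraph W}
    {f g : V → W} (hf : Continuous G H f) (hg : Continuous G H g)
    (h : ∀ x, AdjEq H (f x) (g x)) : Homotopic G H f g := by
  refine ⟨1, fun x t => if t = 0 then f x else g x, by simp, by simp, fun t => ?_, fun x => ?_⟩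
  · by_cases ht : t = 0
    · simpa [ht] using hf
    · simpa [ht] using hg
  · intro s t _
    by_cases hs : s = 0 <;> by_cases ht : t = 0 <;> simp only [hs, ht, if_true, if_false]
    · exact Or.inr rfl
    · exact h x
    · exact (h x).symm
    · exact Or.inr rfl

/-- An image is shrinkable when a single step of homotopy leads from the identity to a continuous
map that is not surjective. -/
def Shrinkable {V : Type u} (G : SimpleGraph V) : Prop :=
  ∃ f : V → V, Continuous G G f ∧ (∀ x, AdjEq G (f x) x) ∧ ¬ Function.Surjective f

theorem Shrinkable.reducible {V : Type u} [Finite V] {G : SimpleGraph V} (h : Shrinkable G) :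
    Reducible G := by
  obtain ⟨f, hf, hid, hsurj⟩ := h
  have hval : Continuous (G.induce (Set.range f)) G Subtype.val := fun _ _ h => Or.inl h
  have hfac : Continuous G (G.induce (Set.range f)) (Set.rangeFactorization f) :=
    fun x y h => (hf x y h).imp id Subtype.ext
  refine ⟨inferInstance, Set.range f, G.induce (Set.range f), inferInstance, ?_,
    Set.rangeFactorization f, Subtype.val, hfac, hval, ?_, ?_⟩
  · exact Set.ncard_lt_card fun h => hsurj (Set.range_eq_univ.1 h)
  · exact homotopic_of_adjEq (hfac.comp hval) (continuous_id _)
      fun x => (hid x).imp id Subtype.ext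
  · exact homotopic_of_adjEq hf (continuous_id _) hid

/-- The inverse is a power of the permutation, hence again continuous. -/
theorem Continuous.perm_symm {V : Type u} [Finite V] {G : SimpleGraph V} {σ : Equiv.Perm V}
    (h : Continuous G G σ) : Continuous G G σ.symm := by
  obtain ⟨n, hn⟩ : σ⁻¹ ∈ Submonoid.powers σ :=
    mem_powers_iff_mem_zpowers.2 (inv_mem (Subgroup.mem_zpowers σ))
  have hpow : ∀ n : ℕ, Continuous G G (σ ^ n : Equiv.Perm V) := fun n => by
    induction n with
    | zero => exact continuous_id G
    | succ n ih => exact ih.comp h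
  have : Continuous G G (σ⁻¹ : Equiv.Perm V) := hn ▸ hpow n
  exact this

/-- Surjectivity passes along one step of homotopy: otherwise, composing with the inverse of the
surjective map would shrink the image. -/
theorem surjective_of_adjEq {V : Type u} [Finite V] {G : SimpleGraph V} (hG : ¬ Shrinkable G)
    {f g : V → V} (hf : Continuous G G f) (hg : Continuous G G g)
    (h : ∀ x, AdjEq G (f x) (g x)) (hsurj : Function.Surjective g) : Function.Surjective f := by
  by_contra hf'
  let σ : Equiv.Perm V := Equiv.ofBijective g (Finite.surjective_iff_bijective.1 hsurj)
  have hσ : Continuous G G σ.symm := Continuous.perm_symm hg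
  refine hG ⟨f ∘ σ.symm, hf.comp hσ, fun x => ?_, fun hs => hf' hs.of_comp⟩
  have := h (σ.symm x)
  rwa [show g (σ.symm x) = x from σ.apply_symm_apply x] at this

theorem Homotopic.surjective {V : Type u} [Finite V] {G : SimpleGraph V} (hG : ¬ Shrinkable G)
    {f : V → V} (h : Homotopic G G f id) : Function.Surjective f := by
  obtain ⟨k, F, h0, h1, hc, hp⟩ := h
  have key : ∀ t, Function.Surjective fun x => F x t := by
    intro t
    induction t using Fin.reverseInduction with
    | last => simpa only [h1] using Function.surjective_id
    | cast i ih =>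
      refine surjective_of_adjEq hG (hc _) (hc _) (fun x => hp x _ _ ?_) ih
      simp [SimpleGraph.pathGraph_adj]
  simpa only [h0] using key 0

theorem Homotopic.continuous_left {V : Type u} {W : Type v} {G : SimpleGraph V}
    {H : SimpleGraph W} {f g : V → W} (h : Homotopic G H f g) : Continuous G H f := by
  obtain ⟨k, F, h0, -, hc, -⟩ := h
  simpa only [h0] using hc 0

theorem reducible_iff_shrinkable {V : Type u} [Finite V] {G : SimpleGraph V} :
    Reducible G ↔ Shrinkable G := by
  refine ⟨fun ⟨_, W, H, _, hlt, f, g, _, _, _, hgf⟩ => ?_, Shrinkable.reducible⟩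
  by_contra hG
  exact hlt.not_ge (Nat.card_le_card_of_surjective g (hgf.surjective hG).of_comp)

theorem irreducible_iff_not_shrinkable {V : Type u} [Finite V] {G : SimpleGraph V} :
    Irreducible G ↔ ¬ Shrinkable G := by
  rw [Irreducible, reducible_iff_shrinkable, and_iff_right ‹Finite V›]

/-- Both composites of the two homotopy inverses are permutations with continuous inverse, so the
two maps are bijections that preserve and reflect adjacency. -/
theorem HomotopyEquiv.nonempty_iso {V : Type u} {W : Type v} [Finite V] [Finite W]
    {G : SimpleGraph V} {H : SimpleGraph W} (hG : ¬ Shrinkable G) (hH : ¬ Shrinkable H)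
    (h : HomotopyEquiv G H) : Nonempty (G ≃g H) := by
  obtain ⟨f, g, hf, hg, hfg, hgf⟩ := h
  have hgf' := Finite.surjective_iff_bijective.1 (hgf.surjective hG)
  have hfb : Function.Bijective f := ⟨hgf'.1.of_comp, (hfg.surjective hH).of_comp⟩
  let σ : Equiv.Perm V := Equiv.ofBijective _ hgf'
  have hσ : Continuous G G σ.symm := Continuous.perm_symm hgf.continuous_left
  refine ⟨⟨Equiv.ofBijective f hfb, fun {x y} => ⟨fun h => ?_, fun h => ?_⟩⟩⟩
  · have h1 : AdjEq G (σ x) (σ y) := hg _ _ h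
    have h2 := hσ.adjEq h1
    rw [σ.symm_apply_apply, σ.symm_apply_apply] at h2
    exact h2.resolve_right fun hxy => h.ne (congrArg f hxy)
  · exact (hf x y h).resolve_right fun hxy => h.ne (hfb.1 hxy)

/-! ### The two elementary reductions -/

/-- Moving the single point `x` to `y` shrinks the image. -/
theorem HasPointReduction.shrinkable {V : Type u} {G : SimpleGraph V}
    (h : HasPointReduction G) : Shrinkable G := by
  classical
  obtain ⟨x, y, hxy, hN⟩ := h
  have hx : ∀ z, AdjEq G z x → AdjEq G z y := fun z hz => hN hz
  refine ⟨Function.update id x y, fun a b hab => ?_, fun a => ?_, fun hs => ?_⟩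
  · by_cases ha : a = x <;> by_cases hb : b = x <;> simp [ha, hb]
    · exact Or.inr rfl
    · exact (hx b (Or.inl (ha ▸ hab.symm))).symm
    · exact hx a (Or.inl (hb ▸ hab))
    · exact Or.inl hab
  · by_cases ha : a = x
    · subst ha
      simpa using (hx a (Or.inr rfl)).symm
    · simp [ha, AdjEq]
  · obtain ⟨a, ha⟩ := hs x
    by_cases hax : a = x <;> simp [hax] at ha
    exact hxy ha.symm

/-- Moving every point to a neighbour in the dominating complete subgraph `S` shrinks the image.
When `S` is the whole image, a constant map does it. -/
theorem HasSimplexReduction.shrinkable {V : Type u} [Nontrivial V] {G : SimpleGraph V}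
    (h : HasSimplexReduction G) : Shrinkable G := by
  obtain ⟨S, hS, hdom⟩ := h
  have hclique : ∀ a ∈ S, ∀ b ∈ S, AdjEq G a b := fun a ha b hb => by
    by_cases hab : a = b
    · exact Or.inr hab
    · exact Or.inl (hS ha hb hab)
  by_cases hu : S = Set.univ
  · obtain ⟨a, b, hab⟩ := exists_pair_ne V
    refine ⟨fun _ => a, fun _ _ _ => Or.inr rfl,
      fun x => hclique a (hu ▸ trivial) x (hu ▸ trivial), fun hs => ?_⟩
    obtain ⟨_, hc⟩ := hs b
    exact hab hc
  · choose f hfS hf using hdom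
    refine ⟨f, fun x y _ => hclique _ (hfS x) _ (hfS y), fun x => (hf x).symm, fun hs => hu ?_⟩
    refine Set.eq_univ_of_forall fun x => ?_
    obtain ⟨y, rfl⟩ := hs x
    exact hfS y

/-! ### Invariance under isomorphism -/

theorem adjEq_iso {V : Type u} {W : Type v} {G : SimpleGraph V} {H : SimpleGraph W}
    (e : G ≃g H) {x y : V} : AdjEq H (e x) (e y) ↔ AdjEq G x y :=
  or_congr e.map_adj_iff e.injective.eq_iff

theorem Shrinkable.of_iso {V : Type u} {W : Type v} {G : SimpleGraph V} {H : SimpleGraph W}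
    (e : G ≃g H) (h : Shrinkable G) : Shrinkable H := by
  obtain ⟨f, hf, hid, hs⟩ := h
  refine ⟨fun x => e (f (e.symm x)), fun x y hxy => ?_, fun x => ?_, fun hs' => hs fun y => ?_⟩
  · exact (adjEq_iso e).2 (hf _ _ (e.symm.map_adj_iff.2 hxy))
  · rw [← adjEq_iso e.symm, e.symm_apply_apply]
    exact hid _
  · obtain ⟨x, hx⟩ := hs' (e y)
    exact ⟨_, e.injective hx⟩

theorem HasPointReduction.of_iso {V : Type u} {W : Type v} {G : SimpleGraph V}
    {H : SimpleGraph W} (e : G ≃g H) (h : HasPointReduction G) : HasPointReduction H := by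
  obtain ⟨x, y, hxy, hN⟩ := h
  refine ⟨e x, e y, e.injective.ne hxy, fun z hz => ?_⟩
  obtain ⟨z, rfl⟩ := e.surjective z
  exact (adjEq_iso e).2 (hN ((adjEq_iso e).1 hz))

theorem HasSimplexReduction.of_iso {V : Type u} {W : Type v} {G : SimpleGraph V}
    {H : SimpleGraph W} (e : G ≃g H) (h : HasSimplexReduction G) : HasSimplexReduction H := by
  obtain ⟨S, hS, hdom⟩ := h
  refine ⟨e '' S, ?_, fun x => ?_⟩
  · rintro _ ⟨a, ha, rfl⟩ _ ⟨b, hb, rfl⟩ hab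
    exact e.map_adj_iff.2 (hS ha hb fun h => hab (congrArg e h))
  · obtain ⟨x, rfl⟩ := e.surjective x
    obtain ⟨s, hs, hxs⟩ := hdom x
    exact ⟨e s, ⟨s, hs, rfl⟩, (adjEq_iso e).2 hxs⟩

theorem homotopyEquiv_of_iso {V : Type u} {W : Type v} {G : SimpleGraph V}
    {H : SimpleGraph W} (e : G ≃g H) : HomotopyEquiv G H := by
  have he : Continuous G H e := fun x y h => Or.inl (e.map_adj_iff.2 h)
  have he' : Continuous H G e.symm := fun x y h => Or.inl (e.symm.map_adj_iff.2 h)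
  refine ⟨e, e.symm, he, he', ?_, ?_⟩
  · exact homotopic_of_adjEq (he.comp he') (continuous_id H) fun x => Or.inr (by simp)
  · exact homotopic_of_adjEq (he'.comp he) (continuous_id G) fun x => Or.inr (by simp)

theorem ncard_closedNbhd_iso {V : Type u} {W : Type v} {G : SimpleGraph V}
    {H : SimpleGraph W} (e : G ≃g H) (x : V) :
    (closedNbhd H (e x)).ncard = (closedNbhd G x).ncard := by
  rw [← Set.ncard_image_of_injective (closedNbhd G x) e.injective]
  congr 1
  ext z
  obtain ⟨z, rfl⟩ := e.surjective z
  simp only [closedNbhd, Set.mem_ofPred_eq, adjEq_iso, Set.mem_image, e.injective.eq_iff,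
    exists_eq_right]

/-! ### Bit codes of images -/

/-- A binary relation on the points `0, …, 6` is encoded by a natural number `c`: bit `7 * x + y`
tells whether `x` and `y` are related. The raw operations on `ℕ`, here and below, are those that
the kernel evaluates directly. -/
def rel (c : ℕ) (x y : Fin 7) : Bool :=
  Nat.beq (Nat.land 1 (Nat.shiftRight c (Nat.add (Nat.mul 7 x.val) y.val))) 1

/-- The seven bits of the code `c` that belong to the point `x`. -/
def row (c : ℕ) (x : Fin 7) : ℕ :=
  Nat.land 127 (Nat.shiftRight c (Nat.mul 7 x.val))

/-- Whether all bits of `a` are bits of `b`. -/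
def bitSubset (a b : ℕ) : Bool :=
  Nat.beq (Nat.land a b) a

/-- Whether `p` holds for some point. -/
def anyPoint (p : Fin 7 → Bool) : Bool :=
  p ⟨0, by decide⟩ || p ⟨1, by decide⟩ || p ⟨2, by decide⟩ || p ⟨3, by decide⟩ ||
    p ⟨4, by decide⟩ || p ⟨5, by decide⟩ || p ⟨6, by decide⟩

/-- The number of points related to `x`. -/
def size (c : ℕ) (x : Fin 7) : ℕ :=
  (rel c x ⟨0, by decide⟩).toNat + (rel c x ⟨1, by decide⟩).toNat +
    (rel c x ⟨2, by decide⟩).toNat + (rel c x ⟨3, by decide⟩).toNat +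
    (rel c x ⟨4, by decide⟩).toNat + (rel c x ⟨5, by decide⟩).toNat +
    (rel c x ⟨6, by decide⟩).toNat

/-- The code `c` encodes the relation "adjacent or equal" of the image `G`. -/
def Encodes (c : ℕ) (G : SimpleGraph (Fin 7)) : Prop :=
  ∀ x y, rel c x y = true ↔ AdjEq G x y

theorem rel_eq_testBit (c : ℕ) (x y : Fin 7) : rel c x y = c.testBit (7 * x.val + y.val) := by
  have h : ∀ n : ℕ, (Nat.beq (Nat.land 1 n) 1) = (1 &&& n != 0) := by
    intro n
    change Nat.beq (1 &&& n) 1 = _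
    rw [Nat.one_and_eq_mod_two]
    rcases Nat.mod_two_eq_zero_or_one n with h | h <;> rw [h] <;> rfl
  exact h _

theorem testBit_row (c : ℕ) (x : Fin 7) (i : ℕ) :
    (row c x).testBit i = (decide (i < 7) && c.testBit (7 * x.val + i)) := by
  change ((2 ^ 7 - 1) &&& (c >>> (7 * x.val))).testBit i = _
  rw [Nat.testBit_and, Nat.testBit_two_pow_sub_one, Nat.testBit_shiftRight]

theorem testBit_row_val (c : ℕ) (x y : Fin 7) : (row c x).testBit y.val = rel c x y := by
  rw [testBit_row, rel_eq_testBit, decide_eq_true y.isLt, Bool.true_and]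

theorem bitSubset_iff (a b : ℕ) :
    bitSubset a b = true ↔ ∀ i, a.testBit i = true → b.testBit i = true := by
  rw [bitSubset, Nat.beq_eq]
  change a &&& b = a ↔ _
  constructor
  · intro h i hi
    rw [← h, Nat.testBit_and, Bool.and_eq_true] at hi
    exact hi.2
  · intro h
    refine Nat.eq_of_testBit_eq fun i => ?_
    rw [Nat.testBit_and]
    specialize h i
    cases ha : a.testBit i <;> simp_all

theorem bitSubset_row (c d : ℕ) (x y : Fin 7) :
    bitSubset (row c x) (row d y) = true ↔ ∀ z, rel c x z = true → rel d y z = true := by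
  rw [bitSubset_iff]
  constructor
  · intro h z
    simpa only [testBit_row_val] using h z.val
  · intro h i hi
    have hi7 : i < 7 := by
      rw [testBit_row, Bool.and_eq_true, decide_eq_true_iff] at hi
      exact hi.1
    have := h ⟨i, hi7⟩
    rw [← testBit_row_val, ← testBit_row_val] at this
    exact this hi

theorem anyPoint_iff (p : Fin 7 → Bool) : anyPoint p = true ↔ ∃ x, p x = true := by
  simp only [anyPoint, Bool.or_eq_true, Fin.exists_fin_succ, Fin.exists_fin_zero, or_false,
    or_assoc]
  rfl

theorem size_eq_ncard (c : ℕ) (x : Fin 7) : size c x = {y | rel c x y = true}.ncard := by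
  have h : ∀ b : Bool, b.toNat = if b = true then 1 else 0 := by decide
  rw [Set.ncard_eq_toFinset_card', Set.toFinset_ofPred, Finset.card_filter, Fin.sum_univ_seven]
  simp only [size, h]
  rfl

theorem Encodes.size_eq {c : ℕ} {G : SimpleGraph (Fin 7)} (h : Encodes c G) (x : Fin 7) :
    size c x = (closedNbhd G x).ncard := by
  rw [size_eq_ncard]
  congr 1
  ext y
  exact (h x y).trans adjEq_comm

theorem Encodes.adj_iff {c : ℕ} {G : SimpleGraph (Fin 7)} (h : Encodes c G) {x y : Fin 7}
    (hxy : x ≠ y) : G.Adj x y ↔ rel c x y = true :=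
  ((h x y).trans (or_iff_left hxy)).symm

theorem Encodes.rel_comm {c : ℕ} {G : SimpleGraph (Fin 7)} (h : Encodes c G) (x y : Fin 7) :
    rel c x y = rel c y x := by
  rw [Bool.eq_iff_iff, h x y, h y x, adjEq_comm]

/-! ### Backtracking search for maps between images -/

/-- The points `0, …, 6`. -/
def points : List (Fin 7) :=
  [⟨0, by decide⟩, ⟨1, by decide⟩, ⟨2, by decide⟩, ⟨3, by decide⟩, ⟨4, by decide⟩,
    ⟨5, by decide⟩, ⟨6, by decide⟩]

/-- Whether two points are equal. -/
def eqPoint (x y : Fin 7) : Bool :=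
  Nat.beq x.val y.val

/-- Backtracking search for a map `f` on the points such that `U k (f k)` and `R j (f j) k (f k)`
hold for all `k` and all `j` before `k`. The list `l` holds the values chosen so far, and the first
list the points whose values remain to be chosen. -/
def assign (U : Fin 7 → Fin 7 → Bool) (R : Fin 7 → Fin 7 → Fin 7 → Fin 7 → Bool) :
    List (Fin 7) → List (Fin 7 × Fin 7) → Bool
  | [], _ => true
  | k :: ks, l => anyPoint fun a =>
      U k a && l.all (fun p => R p.1 p.2 k a) && assign U R ks ((k, a) :: l)

/-- Whether the images with codes `c` and `d` are isomorphic. Comparing neighbourhood sizes is redundant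
and only cuts the search short. -/
def isoCode (c d : ℕ) : Bool :=
  assign (fun j a => Nat.beq (size c j) (size d a))
    (fun j a k b => cond (rel c j k) (rel d a b) (!rel d a b) && !eqPoint a b) points []

/-- Whether the image with code `c` is shrinkable. The point `m` is one that the map avoids. -/
def shrinkCode (c : ℕ) : Bool :=
  anyPoint fun m => assign (fun j a => !eqPoint a m && rel c a j)
    (fun j a k b => !rel c j k || rel c a b) points []

theorem eqPoint_iff (x y : Fin 7) : eqPoint x y = true ↔ x = y := by
  rw [eqPoint, Nat.beq_eq, Fin.ext_iff]

theorem not_eqPoint_iff (x y : Fin 7) : (!eqPoint x y) = true ↔ x ≠ y := by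
  rw [Bool.not_eq_true', ← Bool.not_eq_true, eqPoint_iff]

theorem mem_points (x : Fin 7) : x ∈ points := by
  revert x
  decide

theorem nodup_points : points.Nodup := by
  decide

theorem assign_iff (U : Fin 7 → Fin 7 → Bool) (R : Fin 7 → Fin 7 → Fin 7 → Fin 7 → Bool)
    (ks : List (Fin 7)) (l : List (Fin 7 × Fin 7)) (hks : ks.Nodup) :
    assign U R ks l = true ↔ ∃ f : Fin 7 → Fin 7,
      (∀ k ∈ ks, U k (f k) = true ∧ ∀ p ∈ l, R p.1 p.2 k (f k) = true) ∧
      ks.Pairwise fun j k => R j (f j) k (f k) = true := by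
  induction ks generalizing l with
  | nil => simp [assign]
  | cons k ks ih =>
    rw [List.nodup_cons] at hks
    simp only [assign, anyPoint_iff, Bool.and_eq_true, List.all_eq_true, ih _ hks.2,
      List.forall_mem_cons, List.pairwise_cons]
    constructor
    · rintro ⟨a, ⟨hU, hR⟩, f, hf, hp⟩
      have hne : ∀ j ∈ ks, Function.update f k a j = f j := fun j hj =>
        Function.update_of_ne (ne_of_mem_of_not_mem hj hks.1) _ _
      refine ⟨Function.update f k a, ⟨?_, fun j hj => ?_⟩, fun j hj => ?_, ?_⟩
      · rw [Function.update_self]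
        exact ⟨hU, hR⟩
      · rw [hne j hj]
        exact ⟨(hf j hj).1, (hf j hj).2.2⟩
      · rw [hne j hj, Function.update_self]
        exact (hf j hj).2.1
      · refine hp.imp_of_mem fun {i j} hi hj h => ?_
        rwa [hne i hi, hne j hj]
    · rintro ⟨f, ⟨⟨hU, hR⟩, hf⟩, hk, hp⟩
      exact ⟨f k, ⟨hU, hR⟩, f, fun j hj => ⟨(hf j hj).1, hk j hj, (hf j hj).2⟩, hp⟩

theorem assign_points_iff (U : Fin 7 → Fin 7 → Bool)
    (R : Fin 7 → Fin 7 → Fin 7 → Fin 7 → Bool) (hR : ∀ j a k b, R j a k b = R k b j a) :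
    assign U R points [] = true ↔ ∃ f : Fin 7 → Fin 7,
      (∀ k, U k (f k) = true) ∧ ∀ j k, j ≠ k → R j (f j) k (f k) = true := by
  rw [assign_iff U R points [] nodup_points]
  refine exists_congr fun f => and_congr ?_ ⟨fun h j k hjk => ?_, fun h => ?_⟩
  · simp [mem_points]
  · have : Std.Symm fun j k => R j (f j) k (f k) = true := ⟨fun x y h => by rwa [hR]⟩
    exact h.forall (mem_points j) (mem_points k) hjk
  · exact nodup_points.imp fun {j k} hjk => h j k hjk

theorem isoCode_iff {c d : ℕ} {G H : SimpleGraph (Fin 7)} (hc : Encodes c G)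
    (hd : Encodes d H) : isoCode c d = true ↔ Nonempty (G ≃g H) := by
  have hcond : ∀ a b : Bool, cond a b (!b) = true ↔ (b = true ↔ a = true) := by decide
  rw [isoCode, assign_points_iff]
  · simp only [Bool.and_eq_true, Nat.beq_eq, hcond, not_eqPoint_iff, hc.size_eq, hd.size_eq]
    constructor
    · rintro ⟨f, -, h⟩
      have hinj : Function.Injective f := fun j k hjk => by
        by_contra hne
        exact (h j k hne).2 hjk
      refine ⟨⟨Equiv.ofBijective f (Finite.injective_iff_bijective.1 hinj), fun {j k} => ?_⟩⟩
      change H.Adj (f j) (f k) ↔ G.Adj j k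
      by_cases hjk : j = k
      · simp [hjk]
      · rw [hc.adj_iff hjk, hd.adj_iff (hinj.ne hjk)]
        exact (h j k hjk).1
    · rintro ⟨e⟩
      refine ⟨e, fun k => (ncard_closedNbhd_iso e k).symm, fun j k hjk => ⟨?_, e.injective.ne hjk⟩⟩
      rw [hd, hc, adjEq_iso]
  · intro j a k b
    rw [hc.rel_comm j k, hd.rel_comm a b]
    congr 2
    rw [Bool.eq_iff_iff, eqPoint_iff, eqPoint_iff, eq_comm]

theorem shrinkCode_iff {c : ℕ} {G : SimpleGraph (Fin 7)} (hc : Encodes c G) :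
    shrinkCode c = true ↔ Shrinkable G := by
  have himp : ∀ a b : Bool, (!a || b) = true ↔ (a = true → b = true) := by decide
  have hR : ∀ j a k b, (!rel c j k || rel c a b) = (!rel c k j || rel c b a) := fun j a k b => by
    rw [hc.rel_comm j k, hc.rel_comm a b]
  simp only [shrinkCode, anyPoint_iff, assign_points_iff _ _ hR, Bool.and_eq_true, not_eqPoint_iff, himp,
    hc _ _, Shrinkable]
  constructor
  · rintro ⟨m, f, hf, h⟩
    exact ⟨f, fun x y hxy => h x y hxy.ne (Or.inl hxy), fun x => (hf x).2, fun hs =>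
      let ⟨x, hx⟩ := hs m
      (hf x).1 hx⟩
  · rintro ⟨f, hf, hid, hs⟩
    obtain ⟨m, hm⟩ := not_forall.1 hs
    exact ⟨m, f, fun k => ⟨fun h => hm ⟨k, h⟩, hid k⟩, fun j k _ h => hf.adjEq h⟩

/-! ### The fifteen candidates -/

/-- The codes of the fifteen candidates. -/
def code : Fin 15 → ℕ :=
  ![430473893610435, 322756248044515, 531223720610703, 461398323334027, 305163928830947,
    430473895707595, 496212998587315, 469670168339379, 430474969711563, 430543689192395,
    439271062741963, 434623167570867, 362390340481939, 305403407074243, 322507475489747]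

theorem encodes_code (i : Fin 15) : Encodes (code i) (candidate i) := by
  have h : ∀ l : List (Fin 7 × Fin 7), ∀ c : ℕ,
      (∀ x y, rel c x y = decide ((ofEdges l).Adj x y ∨ x = y)) → Encodes c (ofEdges l) :=
    fun l c h x y => by rw [h, decide_eq_true_iff, AdjEq]
  fin_cases i <;> exact h _ _ (by decide +kernel)

theorem candidate_not_iso {i j : Fin 15} (h : i < j) :
    IsEmpty (candidate i ≃g candidate j) := by
  have key : ∀ i j : Fin 15, i < j → isoCode (code i) (code j) = false := by decide +kernel
  rw [← not_nonempty_iff, ← isoCode_iff (encodes_code i) (encodes_code j), key i j h]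
  exact Bool.false_ne_true

theorem candidate_shrinkable_iff (i : Fin 15) : Shrinkable (candidate i) ↔ 3 ≤ i := by
  have key : ∀ i : Fin 15, shrinkCode (code i) = true ↔ 3 ≤ i := by decide +kernel
  rw [← shrinkCode_iff (encodes_code i), key i]

theorem candidate_connected (i : Fin 15) : (candidate i).Connected := by
  have key : ∀ i : Fin 15, ∀ x : Fin 7, x ≠ 0 → ∃ y, y < x ∧ rel (code i) x y = true := by
    decide +kernel
  have hr : ∀ x : Fin 7, (candidate i).Reachable x 0 := by
    intro x
    induction x using WellFoundedLT.induction with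
    | ind x ih =>
      by_cases hx : x = 0
      · rw [hx]
      · obtain ⟨y, hy, hxy⟩ := key i x hx
        exact (((encodes_code i).adj_iff hy.ne').2 hxy).reachable.trans (ih y hy)
  exact (SimpleGraph.connected_iff _).2 ⟨fun x y => (hr x).trans (hr y).symm, inferInstance⟩

/-- Whether the closed neighbourhood of some point `x` for the code `hi` lies in that of another point
`y` for the code `lo`. Then every image between the two has a point reduction. -/
def pointReducible (lo hi : ℕ) : Bool :=
  anyPoint fun x => anyPoint fun y => !eqPoint x y && bitSubset (row hi x) (row lo y)

theorem pointReducible_iff (lo hi : ℕ) : pointReducible lo hi = true ↔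
    ∃ x y, x ≠ y ∧ ∀ z, rel hi x z = true → rel lo y z = true := by
  simp only [pointReducible, anyPoint_iff, Bool.and_eq_true, not_eqPoint_iff, bitSubset_row]

theorem candidate_not_hasPointReduction (i : Fin 15) : ¬ HasPointReduction (candidate i) := by
  rintro ⟨x, y, hxy, hN⟩
  have key : ∀ i : Fin 15, pointReducible (code i) (code i) = false := by decide +kernel
  refine Bool.false_ne_true ((key i).symm.trans ((pointReducible_iff _ _).2 ⟨x, y, hxy, ?_⟩))
  intro z hz
  rw [encodes_code i, adjEq_comm] at hz ⊢
  exact hN hz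

/-- Whether the points given by the bits of `m` do not form a dominating complete subgraph of the
image with code `c`: two of them are neither adjacent nor equal, or some point is neither adjacent
nor equal to any of them. -/
def notDominating (c m : ℕ) : Bool :=
  (anyPoint fun x => m.testBit x.val && !bitSubset m (row c x)) ||
    anyPoint fun x => Nat.beq (Nat.land m (row c x)) 0

theorem candidate_not_hasSimplexReduction (i : Fin 15) :
    ¬ HasSimplexReduction (candidate i) := by
  classical
  rintro ⟨S, hS, hdom⟩
  have key : ∀ i : Fin 15, ∀ m : Fin 128, notDominating (code i) m.val = true := by
    decide +kernel
  let m := Nat.ofBits fun x : Fin 7 => decide (x ∈ S)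
  have hm : ∀ j, m.testBit j = true ↔ ∃ x : Fin 7, x.val = j ∧ x ∈ S := by
    intro j
    by_cases hj : j < 7
    · rw [Nat.testBit_ofBits_lt _ _ hj, decide_eq_true_iff]
      exact ⟨fun h => ⟨_, rfl, h⟩, fun ⟨x, hx, h⟩ => by subst hx; exact h⟩
    · rw [Nat.testBit_ofBits_ge _ _ (not_lt.1 hj)]
      exact ⟨fun h => absurd h Bool.false_ne_true, fun ⟨x, hx, _⟩ => absurd (hx ▸ x.isLt) hj⟩
  have h := key i ⟨m, Nat.ofBits_lt_two_pow _⟩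
  rw [notDominating, Bool.or_eq_true, anyPoint_iff, anyPoint_iff] at h
  rcases h with ⟨x, hx⟩ | ⟨x, hx⟩
  · rw [Bool.and_eq_true, Bool.not_eq_true', ← Bool.not_eq_true, bitSubset_iff, hm] at hx
    obtain ⟨⟨x', hx', hxS⟩, hsub⟩ := hx
    obtain rfl := Fin.ext hx'
    refine hsub fun j hj => ?_
    obtain ⟨y, rfl, hy⟩ := (hm j).1 hj
    rw [testBit_row_val, encodes_code i]
    by_cases hxy : x' = y
    · exact Or.inr hxy
    · exact Or.inl (hS hxS hy hxy)
  · obtain ⟨s, hs, hxs⟩ := hdom x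
    rw [Nat.beq_eq] at hx
    have hx' : (m &&& row (code i) x).testBit s.val = false :=
      (congrArg (Nat.testBit · s.val) hx).trans (Nat.zero_testBit _)
    rw [Nat.testBit_and, (hm _).2 ⟨s, rfl, hs⟩, testBit_row_val,
      (encodes_code i x s).2 hxs] at hx'
    exact Bool.false_ne_true hx'.symm

/-! ### Sorted labellings -/

/-- The point `0` has the largest neighbourhood, its neighbours come next, and both the neighbours
and the other points are listed in order of decreasing neighbourhood. -/
def Sorted (G : SimpleGraph (Fin 7)) : Prop :=
  (∀ x, (closedNbhd G x).ncard ≤ (closedNbhd G 0).ncard) ∧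
  ∀ x y, 0 < x → x < y → (AdjEq G y 0 → AdjEq G x 0) ∧
    ((AdjEq G x 0 → AdjEq G y 0) → (closedNbhd G y).ncard ≤ (closedNbhd G x).ncard)

/-- Every image of seven points can be relabelled so that it is sorted. -/
theorem exists_sorted {V : Type u} (G : SimpleGraph V) (hV : Nat.card V = 7) :
    ∃ H : SimpleGraph (Fin 7), Nonempty (G ≃g H) ∧ Sorted H := by
  classical
  have : Finite V := Nat.finite_of_card_ne_zero (by omega)
  let e₀ : V ≃ Fin 7 := Finite.equivFinOfCardEq hV
  have : Nonempty V := ⟨e₀.symm 0⟩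
  let d : V → ℕ := fun x => (closedNbhd G x).ncard
  have hd : ∀ x, d x ≤ 7 := fun x => hV ▸ Set.ncard_le_card (closedNbhd G x)
  obtain ⟨v, hv⟩ := Finite.exists_max d
  -- Sorting by this key puts `v` first, then the neighbours of `v`, then all other points.
  let key : V → ℕ := fun x => if x = v then 0 else if AdjEq G x v then 8 - d x else 16 - d x
  let e : Fin 7 ≃ V := (Tuple.sort (key ∘ e₀.symm)).trans e₀.symm
  have hmono : Monotone fun i => key (e i) := Tuple.monotone_sort (key ∘ e₀.symm)
  have he0 : e 0 = v := by
    have h : key (e 0) ≤ key (e (e.symm v)) := hmono (Fin.zero_le _)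
    simp only [e.apply_symm_apply, key, if_true] at h
    have := hd (e 0)
    by_contra hne
    rw [if_neg hne] at h
    split_ifs at h <;> omega
  let E : G.comap e ≃g G := SimpleGraph.Iso.comap e G
  have hadj : ∀ x y, AdjEq (G.comap e) x y ↔ AdjEq G (e x) (e y) := fun x y => (adjEq_iso E).symm
  have hcard : ∀ x, (closedNbhd (G.comap e) x).ncard = d (e x) := fun x =>
    (ncard_closedNbhd_iso E x).symm
  refine ⟨G.comap e, ⟨E.symm⟩, fun x => ?_, fun x y hx hxy => ?_⟩
  · rw [hcard, hcard, he0]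
    exact hv _
  · rw [hcard, hcard, hadj, hadj, he0]
    have hxv : e x ≠ v := fun h => hx.ne (e.injective (he0.trans h.symm))
    have hyv : e y ≠ v := fun h => (hx.trans hxy).ne (e.injective (he0.trans h.symm))
    have h : key (e x) ≤ key (e y) := hmono hxy.le
    simp only [key, if_neg hxv, if_neg hyv] at h
    have := hd (e x)
    have := hd (e y)
    by_cases h1 : AdjEq G (e x) v <;> by_cases h2 : AdjEq G (e y) v <;>
      simp only [h1, h2, if_true, if_false] at h <;> simp only [h1, h2] <;>
      simp <;> omega

/-! ### The search for all unreduced images -/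

/-- The image `G` lies between the graph with code `lo` and the graph with code `hi`. -/
def Between (lo hi : ℕ) (G : SimpleGraph (Fin 7)) : Prop :=
  ∀ x y, (rel lo x y = true → AdjEq G x y) ∧ (AdjEq G x y → rel hi x y = true)

/-- Whether some point is isolated in the graph with code `hi`, and so in every image below it. -/
def isolated (hi : ℕ) : Bool :=
  anyPoint fun x => Nat.beq (row hi x) (Nat.pow 2 x.val)

/-- Whether at most three points form a dominating complete subgraph for the code `lo`, and so in every
image above it. The points `x, y, z` need not be distinct. Larger complete subgraphs are not needed
for the search to succeed. -/
def simplexReducible (lo : ℕ) : Bool :=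
  anyPoint fun x => anyPoint fun y => rel lo x y && anyPoint fun z =>
    rel lo x z && rel lo y z && Nat.beq (Nat.lor (row lo x) (Nat.lor (row lo y) (row lo z))) 127

/-- A test that succeeds only if no image between `lo` and `hi` is sorted. Among the points other
than `0`, only consecutive ones are compared. -/
def unsorted (lo hi : ℕ) : Bool :=
  anyPoint fun x => Nat.blt (size hi ⟨0, by decide⟩) (size lo x) ||
    Nat.blt 0 x.val && anyPoint fun y => Nat.beq (Nat.succ x.val) y.val &&
      (rel lo y ⟨0, by decide⟩ && !rel hi x ⟨0, by decide⟩ ||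
        (!rel hi x ⟨0, by decide⟩ || rel lo y ⟨0, by decide⟩) && Nat.blt (size hi x) (size lo y))

/-- A test that succeeds only if no image between `lo` and `hi` is sorted, without isolated points and
without reductions. -/
def excluded (lo hi : ℕ) : Bool :=
  unsorted lo hi || isolated hi || pointReducible lo hi || simplexReducible lo

/-- The code of the relation that holds between the two points of `e` only, in both directions. -/
def edge (e : Fin 7 × Fin 7) : ℕ :=
  2 ^ (7 * e.1.val + e.2.val) ||| 2 ^ (7 * e.2.val + e.1.val)

/-- Branching search through the images between `lo` and `hi`, which decides successively whether
the listed pairs are edges: whether every image that is found and not excluded is a candidate. -/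
def search : List (Fin 7 × Fin 7) → ℕ → ℕ → Bool
  | [], lo, hi => excluded lo hi || Nat.beq lo hi && (List.finRange 15).any fun i =>
      isoCode lo (code i)
  | e :: es, lo, hi => excluded lo hi ||
      search es (lo ||| edge e) hi && search es lo (hi ^^^ (hi &&& edge e))

theorem rel_edge (e : Fin 7 × Fin 7) (x y : Fin 7) :
    rel (edge e) x y = true ↔ x = e.1 ∧ y = e.2 ∨ x = e.2 ∧ y = e.1 := by
  rw [rel_eq_testBit, edge, Nat.testBit_or, Nat.testBit_two_pow, Nat.testBit_two_pow,
    Bool.or_eq_true, decide_eq_true_iff, decide_eq_true_iff]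
  simp only [Fin.ext_iff]
  omega

theorem Between.add_edge {lo hi : ℕ} {G : SimpleGraph (Fin 7)} (h : Between lo hi G)
    {e : Fin 7 × Fin 7} (he : AdjEq G e.1 e.2) : Between (lo ||| edge e) hi G := by
  refine fun x y => ⟨fun hxy => ?_, (h x y).2⟩
  rw [rel_eq_testBit, Nat.testBit_or, ← rel_eq_testBit, ← rel_eq_testBit, Bool.or_eq_true,
    rel_edge] at hxy
  rcases hxy with hxy | ⟨rfl, rfl⟩ | ⟨rfl, rfl⟩
  · exact (h x y).1 hxy
  · exact he
  · exact he.symm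

theorem Between.remove_edge {lo hi : ℕ} {G : SimpleGraph (Fin 7)} (h : Between lo hi G)
    {e : Fin 7 × Fin 7} (he : ¬ AdjEq G e.1 e.2) :
    Between lo (hi ^^^ (hi &&& edge e)) G := by
  refine fun x y => ⟨(h x y).1, fun hxy => ?_⟩
  have hne : rel (edge e) x y = false := by
    rw [← Bool.not_eq_true, rel_edge]
    rintro (⟨rfl, rfl⟩ | ⟨rfl, rfl⟩)
    · exact he hxy
    · exact he hxy.symm
  rw [rel_eq_testBit, Nat.testBit_xor, Nat.testBit_and, ← rel_eq_testBit, ← rel_eq_testBit, hne,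
    (h x y).2 hxy]
  rfl

theorem Between.size_le {lo hi : ℕ} {G : SimpleGraph (Fin 7)} (h : Between lo hi G) (x : Fin 7) :
    size lo x ≤ (closedNbhd G x).ncard ∧ (closedNbhd G x).ncard ≤ size hi x := by
  rw [size_eq_ncard, size_eq_ncard]
  exact ⟨Set.ncard_le_ncard fun y hy => ((h x y).1 hy).symm,
    Set.ncard_le_ncard fun y hy => (h x y).2 (AdjEq.symm hy)⟩

theorem Between.unsorted_eq_false {lo hi : ℕ} {G : SimpleGraph (Fin 7)} (h : Between lo hi G)
    (hG : Sorted G) : unsorted lo hi = false := by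
  rw [← Bool.not_eq_true, unsorted, anyPoint_iff]
  rintro ⟨x, hx⟩
  simp only [Bool.or_eq_true, Bool.and_eq_true, anyPoint_iff, Nat.blt_eq, Nat.beq_eq,
    Bool.not_eq_true'] at hx
  rcases hx with hx | ⟨hx0, y, hxy, hy⟩
  · have := hG.1 x
    have := (h.size_le x).1
    have : _ ≤ size hi ⟨0, _⟩ := (h.size_le 0).2
    omega
  · have hs := hG.2 x y hx0 (Fin.lt_def.2 (by omega))
    have hhi : rel hi x 0 = false → ¬ AdjEq G x 0 := fun h1 h2 =>
      Bool.false_ne_true (h1.symm.trans ((h x 0).2 h2))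
    rcases hy with ⟨hy, hx⟩ | ⟨hxy', hlt⟩
    · exact hhi hx (hs.1 ((h y 0).1 hy))
    · have := hs.2 fun hx => hxy'.elim (fun h' => absurd hx (hhi h')) fun h' => (h y 0).1 h'
      have := (h.size_le x).2
      have := (h.size_le y).1
      omega

theorem Between.isolated_eq_false {lo hi : ℕ} {G : SimpleGraph (Fin 7)} (h : Between lo hi G)
    (hG : ∀ x, ∃ y, G.Adj x y) : isolated hi = false := by
  rw [← Bool.not_eq_true, isolated, anyPoint_iff]
  rintro ⟨x, hx⟩
  obtain ⟨y, hy⟩ := hG x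
  have hr := (h x y).2 (Or.inl hy)
  rw [← testBit_row_val, Nat.eq_of_beq_eq_true hx] at hr
  change (2 ^ x.val).testBit y.val = true at hr
  rw [Nat.testBit_two_pow, decide_eq_true_iff] at hr
  exact hy.ne (Fin.ext hr)

theorem Between.pointReducible_eq_false {lo hi : ℕ} {G : SimpleGraph (Fin 7)}
    (h : Between lo hi G) (hG : ¬ HasPointReduction G) : pointReducible lo hi = false := by
  rw [← Bool.not_eq_true, pointReducible_iff]
  rintro ⟨x, y, hxy, hN⟩
  exact hG ⟨x, y, hxy, fun z hz => ((h y z).1 (hN z ((h x z).2 (AdjEq.symm hz)))).symm⟩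

theorem Between.simplexReducible_eq_false {lo hi : ℕ} {G : SimpleGraph (Fin 7)}
    (h : Between lo hi G) (hG : ¬ HasSimplexReduction G) : simplexReducible lo = false := by
  rw [← Bool.not_eq_true, simplexReducible]
  simp only [anyPoint_iff, Bool.and_eq_true, Nat.beq_eq]
  rintro ⟨x, y, hxy, z, ⟨hxz, hyz⟩, hrow⟩
  have hadj : ∀ {a b}, rel lo a b = true → a ≠ b → G.Adj a b := fun hab hne =>
    ((h _ _).1 hab).resolve_right hne
  refine hG ⟨{x, y, z}, ?_, fun w => ?_⟩
  · rintro a (rfl | rfl | rfl) b (rfl | rfl | rfl) hne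
    all_goals first
      | exact absurd rfl hne
      | exact hadj ‹_› hne
      | exact (hadj ‹_› hne.symm).symm
  · have hw : (row lo x ||| (row lo y ||| row lo z)).testBit w.val = true := by
      have h127 : ∀ w : Fin 7, (127).testBit w.val = true := by decide
      exact (congrArg (Nat.testBit · w.val) hrow).trans (h127 w)
    rw [Nat.testBit_or, Nat.testBit_or, testBit_row_val, testBit_row_val, testBit_row_val,
      Bool.or_eq_true, Bool.or_eq_true] at hw
    rcases hw with hw | hw | hw
    · exact ⟨x, by simp, ((h _ _).1 hw).symm⟩
    · exact ⟨y, by simp, ((h _ _).1 hw).symm⟩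
    · exact ⟨z, by simp, ((h _ _).1 hw).symm⟩

theorem exists_iso_of_search {G : SimpleGraph (Fin 7)} (hsort : Sorted G)
    (hadj : ∀ x, ∃ y, G.Adj x y) (hp : ¬ HasPointReduction G) (hs : ¬ HasSimplexReduction G)
    (es : List (Fin 7 × Fin 7)) (lo hi : ℕ) (h : Between lo hi G)
    (hsearch : search es lo hi = true) : ∃ i, Nonempty (G ≃g candidate i) := by
  have hex : ∀ {lo hi}, Between lo hi G → excluded lo hi = false := fun h => by
    rw [excluded, h.unsorted_eq_false hsort, h.isolated_eq_false hadj,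
      h.pointReducible_eq_false hp, h.simplexReducible_eq_false hs]
    rfl
  induction es generalizing lo hi with
  | nil =>
    rw [search, hex h, Bool.false_or, Bool.and_eq_true, Nat.beq_eq, List.any_eq_true] at hsearch
    obtain ⟨rfl, i, -, hi⟩ := hsearch
    have henc : Encodes lo G := fun x y => ⟨(h x y).1, (h x y).2⟩
    exact ⟨i, (isoCode_iff henc (encodes_code i)).1 hi⟩
  | cons e es ih =>
    rw [search, hex h, Bool.false_or, Bool.and_eq_true] at hsearch
    by_cases he : AdjEq G e.1 e.2
    · exact ih _ _ (h.add_edge he) hsearch.1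
    · exact ih _ _ (h.remove_edge he) hsearch.2

/-- All pairs of distinct points. -/
def pairs : List (Fin 7 × Fin 7) :=
  [(0, 1), (0, 2), (0, 3), (0, 4), (0, 5), (0, 6), (1, 2), (1, 3), (1, 4), (1, 5), (1, 6),
    (2, 3), (2, 4), (2, 5), (2, 6), (3, 4), (3, 5), (3, 6), (4, 5), (4, 6), (5, 6)]

/-- The search starts with the code `282578800148737` of the edgeless image and the code
`2 ^ 49 - 1` of the complete image. -/
theorem search_pairs : search pairs 282578800148737 562949953421311 = true := by
  decide +kernel

theorem between_edgeless_complete (G : SimpleGraph (Fin 7)) :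
    Between 282578800148737 562949953421311 G := by
  have h : ∀ x y, (rel 282578800148737 x y = true → x = y) ∧
      rel 562949953421311 x y = true := by decide +kernel
  exact fun x y => ⟨fun hxy => Or.inr ((h x y).1 hxy), fun _ => (h x y).2⟩

theorem exists_iso_candidate {V : Type u} {G : SimpleGraph V} (hV : Nat.card V = 7)
    (hconn : G.Connected) (hs : ¬ HasSimplexReduction G) (hp : ¬ HasPointReduction G) :
    ∃ i, Nonempty (G ≃g candidate i) := by
  obtain ⟨H, ⟨e⟩, hsort⟩ := exists_sorted G hV
  have hH : H.Connected := e.connected_iff.1 hconn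
  obtain ⟨i, ⟨e'⟩⟩ := exists_iso_of_search hsort hH.preconnected.exists_adj_of_nontrivial
    (fun h => hp (h.of_iso e.symm)) (fun h => hs (h.of_iso e.symm)) _ _ _
    (between_edgeless_complete H) search_pairs
  exact ⟨i, ⟨e.trans e'⟩⟩

/-! ### The catalog -/

theorem candidate_castLE (i : Fin 3) :
    candidate (Fin.castLE (by decide) i) = catalog i := by
  have h : ∀ (l : List (Fin 7 × Fin 7)) (G : SimpleGraph (Fin 7)) [DecidableRel G.Adj],
      (∀ x y, decide ((ofEdges l).Adj x y) = decide (G.Adj x y)) → ofEdges l = G := by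
    intro l G _ h
    ext x y
    exact decide_eq_decide.1 (h x y)
  fin_cases i
  · exact h _ (SimpleGraph.cycleGraph 7) (by decide +kernel)
  · exact h _ (ofEdges _) (by decide +kernel)
  · exact h _ (ofEdges _) (by decide +kernel)

theorem catalog_not_shrinkable (i : Fin 3) : ¬ Shrinkable (catalog i) := by
  rw [← candidate_castLE, candidate_shrinkable_iff]
  fin_cases i <;> decide

end DigitalImage

open DigitalImage in
theorem theorem4p10 :
    -- the three catalog images are connected, irreducible and pairwise different
    (∀ i, (DigitalImage.catalog i).Connected ∧
      DigitalImage.Irreducible (DigitalImage.catalog i)) ∧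
    (∀ i j, i ≠ j →
      ¬ DigitalImage.HomotopyEquiv (DigitalImage.catalog i) (DigitalImage.catalog j) ∧
      IsEmpty (DigitalImage.catalog i ≃g DigitalImage.catalog j)) ∧
    -- every connected irreducible image of 7 points is homotopy equivalent to one of them
    (∀ (V : Type u) (G : SimpleGraph V), Nat.card V = 7 → G.Connected →
      DigitalImage.Irreducible G →
      ∃ i, DigitalImage.HomotopyEquiv G (DigitalImage.catalog i)) ∧
    -- the connected images of 7 points without the two elementary reductions are exactly the
    -- fifteen candidates, up to isomorphism
    (∀ i j, i ≠ j → IsEmpty (DigitalImage.candidate i ≃g DigitalImage.candidate j)) ∧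
    (∀ (V : Type u) (G : SimpleGraph V), Nat.card V = 7 →
      ((G.Connected ∧ ¬ DigitalImage.HasSimplexReduction G ∧
          ¬ DigitalImage.HasPointReduction G) ↔
        ∃ i, Nonempty (G ≃g DigitalImage.candidate i))) ∧
    -- the first three candidates are the catalog images, and the other twelve are reducible
    Nonempty (DigitalImage.candidate 0 ≃g DigitalImage.c7) ∧
    Nonempty (DigitalImage.candidate 1 ≃g DigitalImage.seven1) ∧
    Nonempty (DigitalImage.candidate 2 ≃g DigitalImage.seven2) ∧
    (∀ i : Fin 15, 3 ≤ i → DigitalImage.Reducible (DigitalImage.candidate i)) := by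
  have hcand : ∀ i j, i ≠ j → IsEmpty (candidate i ≃g candidate j) := fun i j hij => by
    rcases lt_or_gt_of_ne hij with h | h
    · exact candidate_not_iso h
    · exact ⟨fun e => (candidate_not_iso h).false e.symm⟩
  have hcat : ∀ i j, i ≠ j → IsEmpty (catalog i ≃g catalog j) := fun i j hij => by
    rw [← candidate_castLE, ← candidate_castLE]
    exact hcand _ _ fun h => hij (Fin.castLE_injective _ h)
  refine ⟨fun i => ⟨?_, irreducible_iff_not_shrinkable.2 (catalog_not_shrinkable i)⟩,
    fun i j hij => ⟨fun h => ?_, hcat i j hij⟩, fun V G hV hconn hirr => ?_, hcand,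
    fun V G hV => ⟨fun ⟨hconn, hs, hp⟩ => exists_iso_candidate hV hconn hs hp, ?_⟩,
    ⟨candidate_castLE 0 ▸ SimpleGraph.Iso.refl⟩, ⟨candidate_castLE 1 ▸ SimpleGraph.Iso.refl⟩,
    ⟨candidate_castLE 2 ▸ SimpleGraph.Iso.refl⟩,
    fun i hi => ((candidate_shrinkable_iff i).2 hi).reducible⟩
  · rw [← candidate_castLE]
    exact candidate_connected _
  · obtain ⟨e⟩ := h.nonempty_iso (catalog_not_shrinkable i) (catalog_not_shrinkable j)
    exact (hcat i j hij).false e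
  · have : Finite V := hirr.1
    have : Nontrivial V := Finite.one_lt_card_iff_nontrivial.1 (by omega)
    rw [irreducible_iff_not_shrinkable] at hirr
    obtain ⟨i, ⟨e⟩⟩ := exists_iso_candidate hV hconn (fun h => hirr h.shrinkable)
      fun h => hirr h.shrinkable
    have hi : i.val < 3 := by
      by_contra hi
      exact hirr (Shrinkable.of_iso e.symm
        ((candidate_shrinkable_iff i).2 (Fin.le_def.2 (not_lt.1 hi))))
    refine ⟨⟨i.val, hi⟩, homotopyEquiv_of_iso ?_⟩
    rw [← candidate_castLE]
    exact e
  · rintro ⟨i, ⟨e⟩⟩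
    exact ⟨e.connected_iff.2 (candidate_connected i),
      fun h => candidate_not_hasSimplexReduction i (h.of_iso e),
      fun h => candidate_not_hasPointReduction i (h.of_iso e)⟩
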